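/- Conventions. A function $u:D\to[-\infty,+\infty)$ on an open set $D\subset\mathbb C^n$ is plurisubharmonic if it is upper semicontinuous and its restriction to every complex line is subharmonic. An open set $D\subset\mathbb C^n$ (not necessarily connected) is pseudoconvex if there is a continuous plurisubharmonic function $\varphi:D\to\mathbb R$ such that $\{z\in D:\varphi(z)<c\}$ is relatively compact in $D$ for every $c\in\mathbb R$. $B(\zeta,r)$ denotes the open Euclidean ball. Proposition 2.3. Let $\Omega$ be a bounded domain in $\mathbb C^n$ and let $F\subset\partial\Omega$ be a non-empty closed set with the following properties: (1) $\partial\Omega\setminus F$ is locally pseudoconvex, i.e. for every $\zeta\in\partial\Omega\setminus F$ there exists $r>0$ such that $B(\zeta,r)\cap\Omega$ is pseudoconvex; (2) there exist a pseudoconvex open neighbourhood $U$ of $F$ in $\mathbb C^n$ and a continuous plurisubharmonic function $v$ on $U\cap\Omega$ (continuous as a function into $[-\infty,+\infty)$) such that $$F=\Big\{z\in\partial\Omega\cap\overline{U\cap\Omega}:\ \lim_{\xi\to z,\ \xi\in U\cap\Omega}v(\xi)=+\infty\Big\}.$$ Then $\Omega$ is pseudoconvex. -/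

import Mathlib

open Set Filter Topology

/-- A function `f` with values in `[-∞, +∞)` is subharmonic on the open set `s ⊆ ℂ`: it is upper
semicontinuous and satisfies the local submean inequality, `f c` being at most the mean of `f` over
every sufficiently small circle about `c`. Since `f` is bounded above on circles but may be
unbounded below, the mean in `[-∞, +∞)` is the decreasing limit, as `M → -∞`, of the means of the
bounded functions `max f M`; the inequality is therefore required against each of these. -/
structure SubharmonicOn (f : ℂ → EReal) (s : Set ℂ) : Prop where
  lt_top : ∀ z ∈ s, f z < ⊤
  usc : UpperSemicontinuousOn f s
  submean : ∀ c ∈ s, ∀ᶠ r in 𝓝[>] (0 : ℝ), ∀ M : ℝ,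
    f c ≤ ((Real.circleAverage (fun z => (max (f z) (M : EReal)).toReal) c r : ℝ) : EReal)

/-- A function `u` with values in `[-∞, +∞)` is plurisubharmonic on the open set `s`: it is upper
semicontinuous, and its restriction to every complex line is subharmonic. -/
structure PlurisubharmonicOn {n : ℕ} (u : EuclideanSpace ℂ (Fin n) → EReal)
    (s : Set (EuclideanSpace ℂ (Fin n))) : Prop where
  lt_top : ∀ z ∈ s, u z < ⊤
  usc : UpperSemicontinuousOn u s
  subharmonicOn_line : ∀ a b : EuclideanSpace ℂ (Fin n),
    SubharmonicOn (fun τ : ℂ => u (a + τ • b)) {τ : ℂ | a + τ • b ∈ s}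

/-- An open set (not necessarily connected) of `ℂⁿ` is pseudoconvex if it carries a continuous
plurisubharmonic exhaustion function: all sublevel sets are relatively compact in it. -/
def IsPseudoconvex {n : ℕ} (D : Set (EuclideanSpace ℂ (Fin n))) : Prop :=
  IsOpen D ∧ ∃ φ : EuclideanSpace ℂ (Fin n) → ℝ,
    ContinuousOn φ D ∧ PlurisubharmonicOn (fun z => (φ z : EReal)) D ∧
    ∀ c : ℝ, ∃ K : Set (EuclideanSpace ℂ (Fin n)), IsCompact K ∧ K ⊆ D ∧ {z ∈ D | φ z < c} ⊆ K

/-- The part `A` of the boundary of `D` is locally pseudoconvex: each of its points is the centre of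
a ball whose intersection with `D` is pseudoconvex. -/
def IsLocallyPseudoconvexAlong {n : ℕ} (D A : Set (EuclideanSpace ℂ (Fin n))) : Prop :=
  ∀ ζ ∈ A, ∃ r : ℝ, 0 < r ∧ IsPseudoconvex (Metric.ball ζ r ∩ D)

/-! Pseudoconvexity is traded for a continuity principle, `DiscProperty`, which passes to finite
intersections and to increasing unions, whereas exhaustion functions do not. A plurisubharmonic
exhaustion yields the principle through the maximum principle on holomorphic discs
(`discProperty_of_exhaustion`). Conversely, the principle makes minus the logarithm of the boundary
distance plurisubharmonic (Hartogs' argument, `DiscProperty.submeanOn_neg_log_infDist`). For a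
bounded set it is only needed locally at the boundary, since a maximum with a constant removes a
compact part (`exists_exhaustion_of_local_discProperty`).

The only boundary points of `Ω` in doubt are those of `F`. Put `w = max v 0`. Since `v → +∞` at `F`,
the boundary of `{w < c} ⊆ U ∩ Ω` misses `F`, so near each of its points `Ω` satisfies the
principle; intersecting with `U` and taking a sublevel set keeps it. Hence each `{w < c}` is
pseudoconvex. By compactness `U ∩ Ω`, the increasing union of these sets, satisfies the principle,
and it agrees with `Ω` near `F`. -/

open Metric Real in
theorem circleAverage_re_of_differentiable {h : ℂ → ℂ} (hh : Differentiable ℂ h) (r : ℝ) :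
    circleAverage (fun τ => (h τ).re) 0 r = (h 0).re := by
  have h1 : circleAverage h 0 r = h 0 :=
    hh.diffContOnCl.circleAverage
  rw [← h1]
  exact Complex.reCLM.circleAverage_comp_comm (hh.continuous.continuousOn.circleIntegrable'
    (c := 0) (R := r))

/-! ### Submean inequality on complex lines -/

section Submean

variable {E : Type*} [NormedAddCommGroup E] [NormedSpace ℂ E]

/-- The local submean inequality for `φ` on small circles in complex lines. -/
def SubmeanOn (φ : E → ℝ) (s : Set E) : Prop :=
  ∀ z ∈ s, ∀ b : E, ∀ᶠ r in 𝓝[>] (0 : ℝ),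
    φ z ≤ Real.circleAverage (fun τ : ℂ => φ (z + τ • b)) 0 r

theorem eventually_line_mem {s : Set E} (hs : IsOpen s) {z : E} (hz : z ∈ s) (b : E) :
    ∀ᶠ r in 𝓝[>] (0 : ℝ), ∀ τ ∈ Metric.closedBall (0 : ℂ) r, z + τ • b ∈ s := by
  have hc : Continuous fun τ : ℂ => z + τ • b := by fun_prop
  have : (fun τ : ℂ => z + τ • b) ⁻¹' s ∈ 𝓝 (0 : ℂ) :=
    hc.continuousAt.preimage_mem_nhds (hs.mem_nhds (by simpa using hz))
  obtain ⟨ε, hε, h⟩ := Metric.nhds_basis_closedBall.mem_iff.1 this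
  filter_upwards [Ioo_mem_nhdsGT hε] with r hr τ hτ
  exact h (Metric.closedBall_subset_closedBall hr.2.le hτ)

theorem circleIntegrable_line {s : Set E} {φ : E → ℝ} (hφ : ContinuousOn φ s) {z b : E} {r : ℝ}
    (hr : 0 < r) (h : ∀ τ ∈ Metric.closedBall (0 : ℂ) r, z + τ • b ∈ s) :
    CircleIntegrable (fun τ : ℂ => φ (z + τ • b)) 0 r := by
  refine ContinuousOn.circleIntegrable hr.le (hφ.comp (by fun_prop) fun τ hτ => ?_)
  exact h τ (Metric.sphere_subset_closedBall hτ)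

theorem SubmeanOn.mono {φ : E → ℝ} {s t : Set E} (h : SubmeanOn φ s) (hts : t ⊆ s) :
    SubmeanOn φ t := fun z hz => h z (hts hz)

theorem SubmeanOn.congr {φ ψ : E → ℝ} {s : Set E} (hs : IsOpen s) (h : SubmeanOn φ s)
    (hφψ : EqOn φ ψ s) : SubmeanOn ψ s := by
  intro z hz b
  filter_upwards [h z hz b, eventually_line_mem hs hz b, self_mem_nhdsWithin] with r hr hm h0
  rw [← hφψ hz]
  refine hr.trans_eq (Real.circleAverage_congr_sphere fun τ hτ => hφψ (hm τ ?_))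
  rw [abs_of_pos h0] at hτ
  exact Metric.sphere_subset_closedBall hτ

/-- Outside `w` the maximum equals `C`, its global lower bound, so the inequality is trivial there.
-/
theorem SubmeanOn.max_const {φ : E → ℝ} {s w : Set E} (hs : IsOpen s) (hφ : ContinuousOn φ s)
    (h : SubmeanOn φ (s ∩ w)) {C : ℝ} (hC : ∀ z ∈ s \ w, φ z ≤ C) :
    SubmeanOn (fun z => max (φ z) C) s := by
  intro z hz b
  have hcont : ContinuousOn (fun z => max (φ z) C) s := hφ.sup continuousOn_const
  have key : ∀ᶠ r in 𝓝[>] (0 : ℝ),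
      C ≤ Real.circleAverage (fun τ : ℂ => max (φ (z + τ • b)) C) 0 r := by
    filter_upwards [eventually_line_mem hs hz b, self_mem_nhdsWithin] with r hm h0
    calc C = Real.circleAverage (fun _ : ℂ => C) 0 r := (Real.circleAverage_const C 0 r).symm
      _ ≤ _ := Real.circleAverage_mono (by simp) (circleIntegrable_line hcont h0 hm)
        fun τ _ => le_max_right _ _
  by_cases hw : z ∈ w
  · filter_upwards [key, h z ⟨hz, hw⟩ b, eventually_line_mem hs hz b, self_mem_nhdsWithin]
      with r h1 h2 hm h0
    refine max_le (h2.trans ?_) h1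
    exact Real.circleAverage_mono (circleIntegrable_line hφ h0 hm)
      (circleIntegrable_line hcont h0 hm) fun τ _ => le_max_left _ _
  · filter_upwards [key] with r h1
    simpa only [max_eq_right (hC z ⟨hz, hw⟩)] using h1

end Submean

/-! ### Maximum principle on curved discs by doubling of variables -/

section MaximumPrinciple

variable {E : Type*} [NormedAddCommGroup E] [InnerProductSpace ℂ E]

/-- Penalized maxima of `φ z + η |τ|² - ‖z - g τ‖² / ε` are never interior. -/
theorem SubmeanOn.exists_penalized_gt {φ : E → ℝ} {s : Set E} (hs : IsOpen s)
    (hφc : ContinuousOn φ s) (hφ : SubmeanOn φ s) {g : ℂ → E} (hg : Differentiable ℂ g)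
    {η κ : ℝ} (hη : 0 < η) (hκ : 0 < κ) (τ₀ : ℂ) {z₀ : E} (hz₀ : z₀ ∈ s)
    (hmax : ∀ᶠ p in 𝓝 (τ₀, z₀), φ p.2 + η * ‖p.1‖ ^ 2 - κ * ‖p.2 - g p.1‖ ^ 2 ≤
      φ z₀ + η * ‖τ₀‖ ^ 2 - κ * ‖z₀ - g τ₀‖ ^ 2) : False := by
  set b := deriv g τ₀ with hb
  set q := z₀ - g τ₀ with hq
  set R : ℂ → E := fun σ => g (τ₀ + σ) - g τ₀ - σ • b with hR
  have hRd : Differentiable ℂ R := by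
    intro σ
    have : DifferentiableAt ℂ (fun σ => g (τ₀ + σ)) σ :=
      (hg _).comp σ (by fun_prop)
    fun_prop
  -- Move along `(τ₀ + σ, z₀ + σ • b)`. The first-order terms of both squares are real parts of
  -- holomorphic functions, collected in `h`; they average to zero over circles.
  set h : ℂ → ℂ := fun σ =>
    -(2 * η : ℝ) * (starRingEnd ℂ τ₀ * σ) - (2 * κ : ℝ) * inner ℂ q (R σ) with hh
  have hhd : Differentiable ℂ h := by
    have : Differentiable ℂ fun σ => inner ℂ q (R σ) :=
      ((innerSL ℂ q).differentiable).comp hRd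
    fun_prop
  have hR0 : R 0 = 0 := by simp [hR]
  have hh0 : h 0 = 0 := by simp [hh, hR0]
  -- With this `δ` the remainder `κ * ‖R σ‖ ^ 2` uses up at most half of the gain `η * ‖σ‖ ^ 2`.
  obtain ⟨δ, hδ, hδ'⟩ : ∃ δ : ℝ, 0 < δ ∧ κ * δ ^ 2 ≤ η / 2 := by
    refine ⟨√(η / 2 / κ), by positivity, ?_⟩
    rw [Real.sq_sqrt (by positivity)]
    field_simp; rfl
  have hRo : ∀ᶠ σ in 𝓝 (0 : ℂ), ‖R σ‖ ≤ δ * ‖σ‖ := by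
    have := (hasDerivAt_iff_isLittleO_nhds_zero.1 (hg τ₀).hasDerivAt).bound hδ
    simpa [hR, hb] using this
  have hmax' : ∀ᶠ σ in 𝓝 (0 : ℂ), φ (z₀ + σ • b) + η * ‖τ₀ + σ‖ ^ 2
      - κ * ‖z₀ + σ • b - g (τ₀ + σ)‖ ^ 2 ≤ φ z₀ + η * ‖τ₀‖ ^ 2 - κ * ‖z₀ - g τ₀‖ ^ 2 := by
    have hc : Tendsto (fun σ : ℂ => (τ₀ + σ, z₀ + σ • b)) (𝓝 0) (𝓝 (τ₀, z₀)) := by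
      have : Continuous fun σ : ℂ => (τ₀ + σ, z₀ + σ • b) := by fun_prop
      simpa using this.tendsto 0
    exact hc.eventually hmax
  obtain ⟨ρ, hρ, hball⟩ := Metric.eventually_nhds_iff_ball.1 (hRo.and hmax')
  have hle : ∀ σ ∈ Metric.ball (0 : ℂ) ρ,
      φ (z₀ + σ • b) ≤ φ z₀ - η / 2 * ‖σ‖ ^ 2 + (h σ).re := by
    intro σ hσ
    obtain ⟨h1, h2⟩ := hball σ hσ
    have e1 : ‖τ₀ + σ‖ ^ 2 = ‖τ₀‖ ^ 2 + 2 * (starRingEnd ℂ τ₀ * σ).re + ‖σ‖ ^ 2 := by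
      simp only [← Complex.normSq_eq_norm_sq, Complex.normSq_apply, Complex.add_re,
        Complex.add_im, Complex.mul_re, Complex.conj_re, Complex.conj_im]
      ring
    have e2 : z₀ + σ • b - g (τ₀ + σ) = q - R σ := by simp only [hq, hR]; abel
    have e3 : ‖q - R σ‖ ^ 2 = ‖q‖ ^ 2 - 2 * (inner ℂ q (R σ)).re + ‖R σ‖ ^ 2 :=
      norm_sub_sq (𝕜 := ℂ) q (R σ)
    have e4 : (h σ).re = -(2 * η) * (starRingEnd ℂ τ₀ * σ).re - 2 * κ * (inner ℂ q (R σ)).re := by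
      simp only [hh, Complex.sub_re, neg_mul, Complex.neg_re, Complex.re_ofReal_mul]
    have e5 : κ * ‖R σ‖ ^ 2 ≤ η / 2 * ‖σ‖ ^ 2 := by
      calc κ * ‖R σ‖ ^ 2 ≤ κ * (δ * ‖σ‖) ^ 2 := by gcongr
        _ = κ * δ ^ 2 * ‖σ‖ ^ 2 := by ring
        _ ≤ _ := by gcongr
    rw [e2, e3, e1] at h2
    rw [e4]
    nlinarith
  obtain ⟨r, hr1, hr2, hr3⟩ := ((hφ z₀ hz₀ b).and ((eventually_line_mem hs hz₀ b).and
    (Ioo_mem_nhdsGT hρ))).exists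
  have hsum : Real.circleAverage (fun σ => φ z₀ - η / 2 * r ^ 2 + (h σ).re) 0 r
      = φ z₀ - η / 2 * r ^ 2 := by
    have hi : CircleIntegrable (fun σ => (h σ).re) 0 r :=
      (Complex.continuous_re.comp hhd.continuous).continuousOn.circleIntegrable'
    rw [Real.circleAverage_fun_add (circleIntegrable_const _ _ _) hi,
      circleAverage_re_of_differentiable hhd, hh0, Real.circleAverage_const]
    simp
  have := hr1.trans (Real.circleAverage_mono (f₂ := fun σ => φ z₀ - η / 2 * r ^ 2 + (h σ).re)
    (circleIntegrable_line hφc hr3.1 hr2)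
    (Continuous.continuousOn (by
      have := hhd.continuous
      fun_prop)).circleIntegrable' fun σ hσ => by
      rw [abs_of_pos hr3.1, mem_sphere_zero_iff_norm] at hσ
      have := hle σ (by simpa [hσ] using hr3.2)
      rwa [hσ] at this)
  rw [hsum] at this
  have : 0 < η / 2 * r ^ 2 := by have := hr3.1; positivity
  linarith

/-- `SubmeanOn` only tests affine lines, while `g` is curved. Maximizing a penalized function of
independent `τ` and `z` near the graph of `g` replaces `g` by its tangent line at the maximum. -/
theorem SubmeanOn.le_of_disc [ProperSpace E] {φ : E → ℝ} {s : Set E} (hs : IsOpen s)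
    (hφc : ContinuousOn φ s) (hφ : SubmeanOn φ s) {g : ℂ → E} (hg : Differentiable ℂ g)
    {R m : ℝ} (hR : 0 < R) (hgs : ∀ τ ∈ Metric.closedBall (0 : ℂ) R, g τ ∈ s)
    (hm : ∀ τ ∈ Metric.sphere (0 : ℂ) R, φ (g τ) ≤ m) {τ₁ : ℂ}
    (hτ₁ : τ₁ ∈ Metric.closedBall (0 : ℂ) R) : φ (g τ₁) ≤ m := by
  by_contra! hlt
  set A := φ (g τ₁) with hA
  set B := Metric.closedBall (0 : ℂ) R with hB
  have hBc : IsCompact B := isCompact_closedBall _ _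
  have hKc : IsCompact (g '' B) := hBc.image hg.continuous
  obtain ⟨ρ₀, hρ₀, hρ₀s⟩ := hKc.exists_cthickening_subset_open hs
    (by rintro _ ⟨τ, hτ, rfl⟩; exact hgs τ hτ)
  set N := Metric.cthickening ρ₀ (g '' B) with hN
  have hNc : IsCompact N := hKc.cthickening
  have hunif := hNc.uniformContinuousOn_of_continuous (hφc.mono hρ₀s)
  -- Over the bounding circle the penalized function stays below `m + 2 * e < A`: one `e` for the
  -- oscillation of `φ`, one for the `η` term.
  set e := (A - m) / 4 with he
  have hepos : 0 < e := by rw [he]; linarith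
  obtain ⟨ρ₁, hρ₁, hρ₁u⟩ := Metric.uniformContinuousOn_iff.1 hunif e hepos
  set ρ := min ρ₀ (ρ₁ / 2) with hρdef
  have hρ : 0 < ρ := by positivity
  have hgN : ∀ τ ∈ B, g τ ∈ N := fun τ hτ =>
    Metric.self_subset_cthickening _ (mem_image_of_mem g hτ)
  have hzN : ∀ τ ∈ B, ∀ z, ‖z - g τ‖ ≤ ρ → z ∈ N := fun τ hτ z hz =>
    Metric.mem_cthickening_of_dist_le z (g τ) ρ₀ _ (mem_image_of_mem g hτ)
      (by rw [dist_eq_norm]; exact hz.trans (min_le_left _ _))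
  have hnear : ∀ τ ∈ B, ∀ z, ‖z - g τ‖ ≤ ρ → φ z < φ (g τ) + e := by
    intro τ hτ z hz
    have h1 : dist z (g τ) < ρ₁ := by
      rw [dist_eq_norm]
      have := min_le_right ρ₀ (ρ₁ / 2)
      linarith
    have := hρ₁u z (hzN τ hτ z hz) (g τ) (hgN τ hτ) h1
    rw [Real.dist_eq] at this
    linarith [(abs_lt.1 this).2]
  obtain ⟨M, hM⟩ := hNc.bddAbove_image (hφc.mono hρ₀s)
  have hM' : ∀ z ∈ N, φ z ≤ M := fun z hz => hM (mem_image_of_mem φ hz)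
  set η := e / R ^ 2 with hη
  have hηpos : 0 < η := by positivity
  have hηR : ∀ τ ∈ B, η * ‖τ‖ ^ 2 ≤ e := by
    intro τ hτ
    have : ‖τ‖ ≤ R := by simpa [hB] using hτ
    calc η * ‖τ‖ ^ 2 ≤ η * R ^ 2 := by gcongr
      _ = e := by rw [hη]; field_simp
  -- So large a penalty pushes the function below `A` where `‖z - g τ‖ = ρ`, which makes the maximum
  -- interior.
  obtain ⟨κ, hκ, hκM⟩ : ∃ κ : ℝ, 0 < κ ∧ M + e - A < κ * ρ ^ 2 := by
    refine ⟨(|M + e - A| + 1) / ρ ^ 2, by positivity, ?_⟩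
    rw [div_mul_cancel₀ _ (by positivity)]
    linarith [le_abs_self (M + e - A)]
  set T : Set (ℂ × E) := {p | p.1 ∈ B ∧ ‖p.2 - g p.1‖ ≤ ρ} with hT
  have hgc := hg.continuous
  have hTc : IsCompact T := by
    refine (hBc.prod hNc).of_isClosed_subset ?_ fun p hp => ⟨hp.1, hzN _ hp.1 _ hp.2⟩
    exact (Metric.isClosed_closedBall.preimage continuous_fst).inter
      (isClosed_le (f := fun p : ℂ × E => ‖p.2 - g p.1‖) (by fun_prop) continuous_const)
  set Φ : ℂ × E → ℝ := fun p => φ p.2 + η * ‖p.1‖ ^ 2 - κ * ‖p.2 - g p.1‖ ^ 2 with hΦ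
  have hΦc : ContinuousOn Φ T := by
    have : ContinuousOn (fun p : ℂ × E => φ p.2) T :=
      (hφc.mono hρ₀s).comp continuousOn_snd fun p hp => hzN _ hp.1 _ hp.2
    have h2 : ContinuousOn (fun p : ℂ × E => κ * ‖p.2 - g p.1‖ ^ 2) T :=
      Continuous.continuousOn (by fun_prop)
    have h3 : ContinuousOn (fun p : ℂ × E => η * ‖p.1‖ ^ 2) T :=
      Continuous.continuousOn (by fun_prop)
    exact (this.add h3).sub h2
  have hp₁ : (τ₁, g τ₁) ∈ T := ⟨hτ₁, by simpa using hρ.le⟩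
  obtain ⟨⟨τ₀, z₀⟩, hpT, hpmax⟩ := hTc.exists_isMaxOn ⟨_, hp₁⟩ hΦc
  have hge : A ≤ Φ (τ₀, z₀) := by
    refine le_trans ?_ (hpmax hp₁)
    simp only [hΦ, sub_self, norm_zero]
    have : 0 ≤ η * ‖τ₁‖ ^ 2 := by positivity
    linarith
  have hτ₀ : ‖τ₀‖ < R := by
    refine lt_of_le_of_ne (by simpa [hB] using hpT.1) fun heq => ?_
    have h1 := hm τ₀ (by simpa using heq)
    have h2 := hnear τ₀ hpT.1 z₀ hpT.2
    have h3 := hηR τ₀ hpT.1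
    have h4 : 0 ≤ κ * ‖z₀ - g τ₀‖ ^ 2 := by positivity
    simp only [hΦ] at hge
    linarith
  have hz₀ : ‖z₀ - g τ₀‖ < ρ := by
    refine lt_of_le_of_ne hpT.2 fun heq => ?_
    have h1 := hM' z₀ (hzN τ₀ hpT.1 z₀ hpT.2)
    have h3 := hηR τ₀ hpT.1
    simp only [hΦ, heq] at hge
    linarith
  refine hφ.exists_penalized_gt hs hφc hg hηpos hκ τ₀ (hρ₀s (hzN τ₀ hpT.1 z₀ hpT.2)) ?_
  have ho : IsOpen {p : ℂ × E | ‖p.1‖ < R ∧ ‖p.2 - g p.1‖ < ρ} :=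
    (isOpen_lt (f := fun p : ℂ × E => ‖p.1‖) (by fun_prop) continuous_const).inter
      (isOpen_lt (f := fun p : ℂ × E => ‖p.2 - g p.1‖) (by fun_prop) continuous_const)
  filter_upwards [ho.mem_nhds (show (τ₀, z₀) ∈ _ from ⟨hτ₀, hz₀⟩)] with p hp
  exact hpmax ⟨by simpa [hB] using hp.1.le, hp.2.le⟩

end MaximumPrinciple

/-! ### Harmonic approximation on circles -/

section FourierApproximation

/-- Every function continuous on a circle is uniformly close to the real part of an entire
function. -/
theorem exists_differentiable_re_near {u : ℂ → ℝ} {r : ℝ} (hr : 0 < r)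
    (hu : ContinuousOn u (Metric.sphere 0 r)) {ε : ℝ} (hε : 0 < ε) :
    ∃ f : ℂ → ℂ, Differentiable ℂ f ∧ ∀ τ ∈ Metric.sphere (0 : ℂ) r, |u τ - (f τ).re| < ε := by
  have hr' : (r : ℂ) ≠ 0 := by exact_mod_cast hr.ne'
  have : Fact (0 < 2 * Real.pi) := ⟨Real.two_pi_pos⟩
  let e : AddCircle (2 * Real.pi) → ℂ := fun x => (AddCircle.toCircle x : ℂ)
  have hec : Continuous e := continuous_induced_dom.comp AddCircle.continuous_toCircle
  have hes : ∀ x, (r : ℂ) * e x ∈ Metric.sphere (0 : ℂ) r := fun x => by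
    simp [e, abs_of_pos hr, Circle.norm_coe]
  let U : C(AddCircle (2 * Real.pi), ℂ) :=
    ⟨fun x => (u (r * e x) : ℂ), Complex.continuous_ofReal.comp
      (hu.comp_continuous (by fun_prop) hes)⟩
  have hU : U ∈ (Submodule.span ℂ (range <| @fourier (2 * Real.pi))).topologicalClosure := by
    rw [span_fourier_closure_eq_top]; trivial
  obtain ⟨P, hP, hPU⟩ := Metric.mem_closure_iff.1 hU ε hε
  have hrep : ∃ f g : ℂ → ℂ, Differentiable ℂ f ∧ Differentiable ℂ g ∧
      ∀ x, P x = f (e x) + starRingEnd ℂ (g (e x)) := by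
    -- On the unit circle negative frequencies are conjugates of positive powers, and conjugation
    -- does not change real parts.
    refine Submodule.span_induction (p := fun P _ => ∃ f g : ℂ → ℂ, Differentiable ℂ f ∧
      Differentiable ℂ g ∧ ∀ x, P x = f (e x) + starRingEnd ℂ (g (e x))) ?_ ?_ ?_ ?_ hP
    · rintro _ ⟨n, rfl⟩
      obtain ⟨k, rfl | rfl⟩ := n.eq_nat_or_neg
      · refine ⟨fun z => z ^ k, 0, by fun_prop, by fun_prop, fun x => ?_⟩
        simp [fourier_apply, AddCircle.toCircle_nsmul, e]
      · refine ⟨0, fun z => z ^ k, by fun_prop, by fun_prop, fun x => ?_⟩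
        rw [fourier_neg]
        simp [fourier_apply, AddCircle.toCircle_nsmul, e]
    · exact ⟨0, 0, by fun_prop, by fun_prop, by simp⟩
    · rintro P Q _ _ ⟨f, g, hf, hg, h⟩ ⟨f', g', hf', hg', h'⟩
      refine ⟨f + f', g + g', hf.add hf', hg.add hg', fun x => ?_⟩
      simp only [ContinuousMap.add_apply, h, h', Pi.add_apply, map_add]
      ring
    · rintro c P _ ⟨f, g, hf, hg, h⟩
      refine ⟨fun z => c * f z, fun z => starRingEnd ℂ c * g z, by fun_prop, by fun_prop,
        fun x => ?_⟩
      simp only [ContinuousMap.smul_apply, h, smul_eq_mul, map_mul, Complex.conj_conj]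
      ring
  obtain ⟨f, g, hf, hg, hfg⟩ := hrep
  refine ⟨fun τ => f (τ / r) + g (τ / r), ?_, fun τ hτ => ?_⟩
  · have h1 : Differentiable ℂ fun τ : ℂ => τ / r := by fun_prop
    exact (hf.comp h1).add (hg.comp h1)
  have hτ1 : τ / r ∈ Submonoid.unitSphere ℂ := by
    rw [mem_sphere_zero_iff_norm] at hτ
    change τ / r ∈ Metric.sphere (0 : ℂ) 1
    rw [mem_sphere_zero_iff_norm, norm_div, hτ, Complex.norm_real, Real.norm_of_nonneg hr.le, div_self hr.ne']
  obtain ⟨x, hx⟩ := (AddCircle.homeomorphCircle Real.two_pi_pos.ne').surjective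
    (⟨τ / r, hτ1⟩ : Circle)
  have hx' : e x = τ / r := by
    rw [AddCircle.homeomorphCircle_apply] at hx
    simp only [e, hx]
  have h1 : ‖U x - P x‖ < ε := by
    have := (ContinuousMap.dist_apply_le_dist x).trans_lt hPU
    rwa [dist_eq_norm] at this
  have h2 := (Complex.abs_re_le_norm _).trans_lt h1
  rw [hfg] at h2
  simpa [U, hx', mul_div_cancel₀ _ hr'] using h2

end FourierApproximation

/-! ### The continuity principle -/

section DiscProperty

variable {E : Type*} [NormedAddCommGroup E] [NormedSpace ℂ E]

/-- The continuity principle: a continuous family of entire discs whose boundaries lie in `D` and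
whose first member lies in `D` stays in `D`. -/
def DiscProperty (D : Set E) : Prop :=
  ∀ (g : ℝ → ℂ → E) (R : ℝ), 0 < R → Continuous (Function.uncurry g) →
    (∀ t, Differentiable ℂ (g t)) →
    (∀ t ∈ Icc (0 : ℝ) 1, ∀ τ ∈ Metric.sphere (0 : ℂ) R, g t τ ∈ D) →
    (∀ τ ∈ Metric.closedBall (0 : ℂ) R, g 0 τ ∈ D) →
    ∀ t ∈ Icc (0 : ℝ) 1, ∀ τ ∈ Metric.closedBall (0 : ℂ) R, g t τ ∈ D

theorem DiscProperty.inter {D₁ D₂ : Set E} (h₁ : DiscProperty D₁) (h₂ : DiscProperty D₂) :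
    DiscProperty (D₁ ∩ D₂) := fun g R hR hc hd hb h0 t ht τ hτ =>
  ⟨h₁ g R hR hc hd (fun t ht τ hτ => (hb t ht τ hτ).1) (fun τ hτ => (h0 τ hτ).1) t ht τ hτ,
    h₂ g R hR hc hd (fun t ht τ hτ => (hb t ht τ hτ).2) (fun τ hτ => (h0 τ hτ).2) t ht τ hτ⟩

theorem discProperty_ball (ζ : E) (r : ℝ) : DiscProperty (Metric.ball ζ r) := by
  intro g R hR hc hd hb _ t ht τ hτ
  obtain ⟨σ, hσ, hmax⟩ := (isCompact_sphere (0 : ℂ) R).exists_isMaxOn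
    (NormedSpace.sphere_nonempty.2 hR.le)
    (((hd t).sub_const ζ).continuous.norm.continuousOn)
  rw [mem_ball_iff_norm]
  refine lt_of_le_of_lt ?_ (mem_ball_iff_norm.1 (hb t ht σ hσ))
  refine Complex.norm_le_of_forall_mem_frontier_norm_le (U := Metric.ball (0 : ℂ) R)
    (f := fun τ => g t τ - ζ)
    Metric.isBounded_ball ((hd t).sub_const ζ).diffContOnCl (fun z hz => ?_)
    (by rwa [closure_ball _ hR.ne'])
  rw [frontier_ball _ hR.ne'] at hz
  exact hmax hz

/-- A set exhausted by sublevel sets with the continuity principle has it too. -/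
theorem discProperty_of_sublevel {D : Set E} {φ : E → ℝ} (hφ : ContinuousOn φ D)
    (h : ∀ c : ℝ, DiscProperty {z ∈ D | φ z < c}) : DiscProperty D := by
  intro g R hR hc hd hb h0 t ht τ hτ
  have hK : IsCompact (Function.uncurry g '' (Icc (0 : ℝ) 1 ×ˢ Metric.sphere (0 : ℂ) R) ∪
      g 0 '' Metric.closedBall (0 : ℂ) R) :=
    ((isCompact_Icc.prod (isCompact_sphere _ _)).image hc).union
      ((isCompact_closedBall _ _).image (hd 0).continuous)
  obtain ⟨M, hM⟩ := hK.bddAbove_image (hφ.mono (by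
    rintro _ (⟨⟨t, τ⟩, ⟨ht, hτ⟩, rfl⟩ | ⟨τ, hτ, rfl⟩)
    exacts [hb t ht τ hτ, h0 τ hτ]))
  have hM' := fun (z : E) hz => hM (mem_image_of_mem φ (x := z) hz)
  refine (h (M + 1) g R hR hc hd (fun t ht τ hτ => ⟨hb t ht τ hτ, ?_⟩)
    (fun τ hτ => ⟨h0 τ hτ, ?_⟩) t ht τ hτ).1
  · linarith [hM' (g t τ) (Or.inl ⟨(t, τ), ⟨ht, hτ⟩, rfl⟩)]
  · linarith [hM' (g 0 τ) (Or.inr ⟨τ, hτ, rfl⟩)]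

end DiscProperty

/-! ### From plurisubharmonic functions to the continuity principle -/

section DiscPropertyInner

variable {E : Type*} [NormedAddCommGroup E] [InnerProductSpace ℂ E] [ProperSpace E]

theorem DiscProperty.sublevel {D : Set E} (hD : IsOpen D) (h : DiscProperty D) {φ : E → ℝ}
    (hφc : ContinuousOn φ D) (hφ : SubmeanOn φ D) (c : ℝ) :
    DiscProperty {z ∈ D | φ z < c} := by
  intro g R hR hc hd hb h0 t ht τ hτ
  have hin := h g R hR hc hd (fun t ht τ hτ => (hb t ht τ hτ).1) (fun τ hτ => (h0 τ hτ).1) t ht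
  refine ⟨hin τ hτ, ?_⟩
  obtain ⟨σ, hσ, hmax⟩ := (isCompact_sphere (0 : ℂ) R).exists_isMaxOn
    (NormedSpace.sphere_nonempty.2 hR.le)
    (hφc.comp (hd t).continuous.continuousOn fun τ hτ => (hb t ht τ hτ).1)
  exact (hφ.le_of_disc hD hφc (hd t) hR hin (fun τ hτ => hmax hτ) hτ).trans_lt (hb t ht σ hσ).2

/-- A set with a plurisubharmonic exhaustion satisfies the continuity principle. -/
theorem discProperty_of_exhaustion {D : Set E} (hD : IsOpen D) {φ : E → ℝ}
    (hφc : ContinuousOn φ D) (hφ : SubmeanOn φ D)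
    (hex : ∀ c : ℝ, ∃ K : Set E, IsCompact K ∧ K ⊆ D ∧ {z ∈ D | φ z < c} ⊆ K) :
    DiscProperty D := by
  intro g R hR hc hd hb h0 t ht τ hτ
  have hS : IsCompact (Function.uncurry g '' (Icc (0 : ℝ) 1 ×ˢ Metric.sphere (0 : ℂ) R)) :=
    (isCompact_Icc.prod (isCompact_sphere _ _)).image hc
  obtain ⟨M, hM⟩ := hS.bddAbove_image (hφc.mono (by
    rintro _ ⟨⟨t, τ⟩, ⟨ht, hτ⟩, rfl⟩
    exact hb t ht τ hτ))
  obtain ⟨K, hK, hKD, hMK⟩ := hex (M + 1)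
  let B := Metric.closedBall (0 : ℂ) R
  -- `Λ` is shown to be clopen. By the maximum principle, discs lying in `D` lie in the fixed
  -- compact `K`, which gives closedness.
  let Λ : Set (Icc (0 : ℝ) 1) := {t | ∀ τ ∈ B, g t τ ∈ D}
  have hΛK : Λ = {t : Icc (0 : ℝ) 1 | ∀ τ ∈ B, g t τ ∈ K} := by
    ext t
    refine ⟨fun h τ hτ => hMK ⟨h τ hτ, ?_⟩, fun h τ hτ => hKD (h τ hτ)⟩
    refine (hφ.le_of_disc hD hφc (hd t) hR h (fun σ hσ => ?_) hτ).trans_lt (lt_add_one M)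
    exact hM (mem_image_of_mem φ ⟨(↑t, σ), ⟨t.2, hσ⟩, rfl⟩)
  have hcl : IsClosed Λ := by
    rw [hΛK]
    simp only [ofPred_forall]
    refine isClosed_biInter fun τ _ => hK.isClosed.preimage ?_
    exact hc.comp (Continuous.prodMk_left τ |>.comp continuous_subtype_val)
  have hop : IsOpen Λ := by
    rw [isOpen_iff_mem_nhds]
    intro t ht
    have hcc : Continuous fun p : Icc (0 : ℝ) 1 × ℂ => g p.1 p.2 :=
      hc.comp (by fun_prop : Continuous fun p : Icc (0 : ℝ) 1 × ℂ => ((p.1 : ℝ), p.2))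
    exact (isCompact_closedBall (0 : ℂ) R).eventually_forall_of_forall_eventually
      (fun τ hτ => hcc.continuousAt.eventually_mem (hD.mem_nhds (ht τ hτ)))
  have huniv : Λ = univ := IsClopen.eq_univ ⟨hcl, hop⟩ ⟨⟨0, by simp⟩, h0⟩
  exact (huniv ▸ mem_univ (⟨t, ht⟩ : Icc (0 : ℝ) 1) : (⟨t, ht⟩ : Icc (0 : ℝ) 1) ∈ Λ) τ hτ

end DiscPropertyInner

/-! ### From the continuity principle to the boundary distance -/

section BoundaryDistance

variable {E : Type*} [NormedAddCommGroup E] [NormedSpace ℂ E]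

omit [NormedSpace ℂ E] in
theorem continuousOn_neg_log_infDist {D : Set E} (hD : IsOpen D) (hne : Dᶜ.Nonempty) :
    ContinuousOn (fun z => -Real.log (Metric.infDist z Dᶜ)) D := by
  refine (ContinuousOn.log (Metric.continuous_infDist_pt _).continuousOn fun z hz => ?_).neg
  exact ((hD.isClosed_compl.notMem_iff_infDist_pos hne).1 (by simpa using hz)).ne'

/-- If `Re f` slightly exceeds the function on a circle, then `|exp (-f)|` is below the boundary
distance there. Discs displaced by `t * exp (-f)` in a direction `a` have boundary in `D`, so their
centres stay in `D`, which bounds the distance at `z₀` from below. -/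
theorem DiscProperty.submeanOn_neg_log_infDist {D : Set E} (hD : IsOpen D) (hne : Dᶜ.Nonempty)
    (h : DiscProperty D) : SubmeanOn (fun z => -Real.log (Metric.infDist z Dᶜ)) D := by
  have hcont := continuousOn_neg_log_infDist hD hne
  have hpos : ∀ z ∈ D, 0 < Metric.infDist z Dᶜ := fun z hz =>
    (hD.isClosed_compl.notMem_iff_infDist_pos hne).1 (by simpa using hz)
  intro z₀ hz₀ b
  filter_upwards [eventually_line_mem hD hz₀ b, self_mem_nhdsWithin] with r hm hr
  rw [mem_Ioi] at hr
  set u : ℂ → ℝ := fun τ => -Real.log (Metric.infDist (z₀ + τ • b) Dᶜ) with hu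
  have hui : CircleIntegrable u 0 r := circleIntegrable_line hcont hr hm
  refine le_of_forall_pos_le_add fun ε hε => ?_
  -- The shift by `ε / 2` makes the approximation one-sided: `u < Re f < u + ε` on the circle.
  have huc : ContinuousOn (fun τ => u τ + ε / 2) (Metric.sphere 0 r) := by
    refine ContinuousOn.add (hcont.comp (by fun_prop) fun τ hτ => ?_) continuousOn_const
    exact hm τ (Metric.sphere_subset_closedBall hτ)
  obtain ⟨f, hf, hfu⟩ := exists_differentiable_re_near hr huc (half_pos hε)
  have havg : (f 0).re ≤ Real.circleAverage u 0 r + ε := by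
    rw [← circleAverage_re_of_differentiable hf r]
    calc Real.circleAverage (fun τ => (f τ).re) 0 r
        ≤ Real.circleAverage (fun τ => u τ + ε) 0 r := by
          refine Real.circleAverage_mono
            (Complex.continuous_re.comp hf.continuous).continuousOn.circleIntegrable'
            (hui.add (circleIntegrable_const _ _ _)) fun τ hτ => ?_
          rw [abs_of_pos hr] at hτ
          linarith [(abs_lt.1 (hfu τ hτ)).1]
      _ = _ := by
          rw [Real.circleAverage_fun_add hui (circleIntegrable_const _ _ _),
            Real.circleAverage_const]
  refine le_trans ?_ havg
  have hdisc : ∀ a : E, ‖a‖ < 1 → z₀ + Complex.exp (-f 0) • a ∈ D := by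
    intro a ha
    have hfc := hf.continuous
    have := h (fun t τ => z₀ + τ • b + ((t : ℂ) * Complex.exp (-f τ)) • a) r hr
      (by unfold Function.uncurry; fun_prop)
      (fun t => by fun_prop)
      (fun t ht τ hτ => ?_)
      (fun τ hτ => by simpa using hm τ hτ) 1 (by simp) 0 (by simpa using hr.le)
    · simpa using this
    by_contra hnot
    have hτD := hm τ (Metric.sphere_subset_closedBall hτ)
    have h1 := Metric.infDist_le_dist_of_mem (x := z₀ + τ • b) (mem_compl hnot)
    have h2 : Real.exp (-(f τ).re) < Metric.infDist (z₀ + τ • b) Dᶜ := by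
      rw [← Real.lt_log_iff_exp_lt (hpos _ hτD)]
      have := (abs_lt.1 (hfu τ hτ)).2
      simp only [hu] at this
      linarith
    rw [dist_self_add_right, norm_smul, norm_mul, Complex.norm_exp, Complex.norm_real,
      Real.norm_of_nonneg ht.1, Complex.neg_re] at h1
    have h3 : t * Real.exp (-(f τ).re) * ‖a‖ ≤ 1 * Real.exp (-(f τ).re) * 1 := by
      gcongr
      exact ht.2
    linarith
  have hge : Real.exp (-(f 0).re) ≤ Metric.infDist z₀ Dᶜ := by
    refine (Metric.le_infDist hne).2 fun y hy => ?_
    by_contra! hlt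
    refine hy ?_
    have := hdisc (Complex.exp (f 0) • (y - z₀)) ?_
    · rwa [smul_smul, ← Complex.exp_add, neg_add_cancel, Complex.exp_zero, one_smul,
        add_sub_cancel] at this
    · rw [norm_smul, Complex.norm_exp, ← dist_eq_norm, dist_comm]
      calc Real.exp (f 0).re * dist z₀ y < Real.exp (f 0).re * Real.exp (-(f 0).re) := by gcongr
        _ = 1 := by rw [← Real.exp_add]; simp
  rw [← Real.le_log_iff_exp_le (hpos _ hz₀)] at hge
  linarith

/-- If every boundary point of the bounded open set `D` is the centre of a ball whose intersection
with `D` satisfies the continuity principle, then `D` has a plurisubharmonic exhaustion. -/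
theorem exists_exhaustion_of_local_discProperty [ProperSpace E] {D : Set E} (hD : IsOpen D)
    (hb : Bornology.IsBounded D) (hne : Dᶜ.Nonempty)
    (hloc : ∀ ζ ∈ frontier D, ∃ r : ℝ, 0 < r ∧ DiscProperty (Metric.ball ζ r ∩ D)) :
    ∃ φ : E → ℝ, ContinuousOn φ D ∧ SubmeanOn φ D ∧
      ∀ c : ℝ, ∃ K : Set E, IsCompact K ∧ K ⊆ D ∧ {z ∈ D | φ z < c} ⊆ K := by
  choose! r hr hdisc using hloc
  -- In the half-radius ball the centre `ζ ∉ D` is closer than any point outside the full ball, so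
  -- `D` and its local piece have the same boundary distance.
  set W : Set E := ⋃ ζ ∈ frontier D, Metric.ball ζ (r ζ / 2) with hW
  have hWo : IsOpen W := isOpen_biUnion fun _ _ => Metric.isOpen_ball
  set u : E → ℝ := fun z => -Real.log (Metric.infDist z Dᶜ) with hu
  have hcont := continuousOn_neg_log_infDist hD hne
  have hpos : ∀ z ∈ D, 0 < Metric.infDist z Dᶜ := fun z hz =>
    (hD.isClosed_compl.notMem_iff_infDist_pos hne).1 (by simpa using hz)
  have hsub : SubmeanOn u (D ∩ W) := by
    rintro z ⟨hzD, hzW⟩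
    obtain ⟨ζ, hζ, hzζ⟩ := mem_iUnion₂.1 hzW
    have hζD : ζ ∈ Dᶜ := by
      rw [hD.frontier_eq] at hζ
      exact hζ.2
    have hsubset : Dᶜ ⊆ (Metric.ball ζ (r ζ) ∩ D)ᶜ := compl_subset_compl.2 inter_subset_right
    have hne' : (Metric.ball ζ (r ζ) ∩ D)ᶜ.Nonempty := hne.mono hsubset
    have hBo : IsOpen (Metric.ball ζ (r ζ / 2) ∩ D) := Metric.isOpen_ball.inter hD
    refine SubmeanOn.congr (s := Metric.ball ζ (r ζ / 2) ∩ D) hBo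
      (((hdisc ζ hζ).submeanOn_neg_log_infDist (Metric.isOpen_ball.inter hD) hne').mono
      (inter_subset_inter_left _ (Metric.ball_subset_ball (by linarith [hr ζ hζ])))) ?_ z
      ⟨hzζ, hzD⟩
    intro w hw
    simp only [hu]
    congr 2
    refine le_antisymm (Metric.infDist_le_infDist_of_subset hsubset hne) ?_
    refine (Metric.le_infDist hne').2 fun y hy => ?_
    by_cases hyD : y ∈ D
    · have hy' : r ζ ≤ dist y ζ := by
        by_contra! hlt
        exact hy ⟨hlt, hyD⟩
      have h1 : dist w ζ < r ζ / 2 := hw.1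
      have h2 := Metric.infDist_le_dist_of_mem (x := w) hζD
      have h3 := dist_triangle y w ζ
      rw [dist_comm y w] at h3
      linarith
    · exact Metric.infDist_le_dist_of_mem hyD
  have hcompact : IsCompact (D \ W) := by
    have : D \ W = closure D \ W := by
      refine Subset.antisymm (sdiff_subset_sdiff_left subset_closure) fun z hz => ⟨?_, hz.2⟩
      by_contra hzD
      refine hz.2 (mem_iUnion₂.2 ⟨z, ?_, Metric.mem_ball_self ?_⟩)
      · rw [hD.frontier_eq]; exact ⟨hz.1, hzD⟩
      · have := hr z (by rw [hD.frontier_eq]; exact ⟨hz.1, hzD⟩)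
        linarith
    rw [this]
    exact hb.isCompact_closure.diff hWo
  obtain ⟨C, hC⟩ := hcompact.bddAbove_image (hcont.mono sdiff_subset)
  refine ⟨fun z => max (u z) C, hcont.sup continuousOn_const,
    SubmeanOn.max_const hD hcont hsub fun z hz => hC (mem_image_of_mem _ hz), fun c => ?_⟩
  have hKD : {z | Real.exp (-c) ≤ Metric.infDist z Dᶜ} ⊆ D := by
    intro z hz
    by_contra hzD
    have := Metric.infDist_zero_of_mem (mem_compl hzD)
    have h2 : Real.exp (-c) ≤ Metric.infDist z Dᶜ := hz
    linarith [Real.exp_pos (-c)]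
  refine ⟨_, Metric.isCompact_of_isClosed_isBounded
    (isClosed_le continuous_const (Metric.continuous_infDist_pt _)) (hb.subset hKD), hKD, ?_⟩
  rintro z ⟨hzD, hz⟩
  have h1 : u z < c := (le_max_left _ _).trans_lt hz
  simp only [hu] at h1
  exact (Real.le_log_iff_exp_le (hpos z hzD)).1 (by linarith)

end BoundaryDistance

/-! ### Translation to `PlurisubharmonicOn` and `IsPseudoconvex` -/

section Pseudoconvex

variable {n : ℕ}

theorem PlurisubharmonicOn.submeanOn {φ : EuclideanSpace ℂ (Fin n) → ℝ}
    {s : Set (EuclideanSpace ℂ (Fin n))} (hs : IsOpen s) (hφc : ContinuousOn φ s)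
    (hφ : PlurisubharmonicOn (fun z => (φ z : EReal)) s) : SubmeanOn φ s := by
  intro z hz b
  have h := (hφ.subharmonicOn_line z b).submean 0 (by simpa using hz)
  filter_upwards [h, eventually_line_mem hs hz b, self_mem_nhdsWithin] with r h1 hm hr
  rw [mem_Ioi] at hr
  have hc : ContinuousOn (fun τ : ℂ => φ (z + τ • b)) (Metric.sphere 0 r) :=
    hφc.comp (by fun_prop) fun τ hτ => hm τ (Metric.sphere_subset_closedBall hτ)
  -- Truncating at a lower bound of `φ` on the circle changes nothing.
  obtain ⟨M, hM⟩ := (isCompact_sphere (0 : ℂ) r).bddBelow_image hc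
  have h2 := h1 M
  simp only [zero_smul, add_zero, EReal.coe_le_coe_iff] at h2
  refine h2.trans_eq (Real.circleAverage_congr_sphere fun τ hτ => ?_)
  rw [abs_of_pos hr] at hτ
  have : M ≤ φ (z + τ • b) := hM (mem_image_of_mem _ hτ)
  rw [max_eq_left (EReal.coe_le_coe_iff.2 this), EReal.toReal_coe]

theorem PlurisubharmonicOn.submeanOn_max_zero {v : EuclideanSpace ℂ (Fin n) → EReal}
    {s : Set (EuclideanSpace ℂ (Fin n))} (hv : PlurisubharmonicOn v s) :
    SubmeanOn (fun z => (max (v z) 0).toReal) s := by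
  intro z hz b
  have h := (hv.subharmonicOn_line z b).submean 0 (by simpa using hz)
  filter_upwards [h] with r h1
  have h2 := h1 0
  simp only [zero_smul, add_zero, EReal.coe_zero] at h2
  have h3 : 0 ≤ Real.circleAverage (fun τ : ℂ => (max (v (z + τ • b)) 0).toReal) 0 r :=
    Real.circleAverage_nonneg_of_nonneg fun τ _ => EReal.toReal_nonneg (le_max_right _ _)
  have h4 := EReal.toReal_le_toReal (max_le h2 (EReal.coe_nonneg.2 h3))
    (ne_bot_of_le_ne_bot EReal.zero_ne_bot (le_max_right _ _)) (EReal.coe_ne_top _)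
  rwa [EReal.toReal_coe] at h4

theorem ContinuousOn.toReal_max_zero {v : EuclideanSpace ℂ (Fin n) → EReal}
    {s : Set (EuclideanSpace ℂ (Fin n))} (hvc : ContinuousOn v s) (hv : ∀ z ∈ s, v z < ⊤) :
    ContinuousOn (fun z => (max (v z) 0).toReal) s := by
  refine EReal.continuousOn_toReal.comp (hvc.sup continuousOn_const) fun z hz => ?_
  simp only [mem_compl_iff, mem_insert_iff, mem_singleton_iff, not_or]
  refine ⟨fun h => ?_, (max_lt (hv z hz) EReal.zero_lt_top).ne⟩
  have := le_max_right (v z) 0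
  simp [h] at this

theorem SubmeanOn.plurisubharmonicOn {φ : EuclideanSpace ℂ (Fin n) → ℝ}
    {s : Set (EuclideanSpace ℂ (Fin n))} (hs : IsOpen s) (hφc : ContinuousOn φ s)
    (hφ : SubmeanOn φ s) : PlurisubharmonicOn (fun z => (φ z : EReal)) s := by
  have hE : ContinuousOn (fun z => (φ z : EReal)) s := continuous_coe_real_ereal.comp_continuousOn hφc
  refine ⟨fun z _ => EReal.coe_lt_top _, hE.upperSemicontinuousOn, fun a b =>
    ⟨fun z _ => EReal.coe_lt_top _, ?_, fun c hc => ?_⟩⟩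
  · exact (hE.comp (f := fun τ : ℂ => a + τ • b) (t := s) (by fun_prop)
      fun τ hτ => hτ).upperSemicontinuousOn
  filter_upwards [hφ _ hc b, eventually_line_mem hs hc b, self_mem_nhdsWithin] with r h1 hm hr M
  rw [mem_Ioi] at hr
  rw [← Real.circleAverage_map_add_const, EReal.coe_le_coe_iff]
  have heq : ∀ x : ℝ, (max (x : EReal) M).toReal = max x M := fun x => by
    rw [← EReal.coe_strictMono.monotone.map_max, EReal.toReal_coe]
  have hline : ∀ τ : ℂ, a + (τ + c) • b = a + c • b + τ • b := fun τ => by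
    rw [add_smul]; abel
  simp only [heq, hline]
  exact h1.trans (Real.circleAverage_mono (circleIntegrable_line hφc hr hm)
    (circleIntegrable_line (φ := fun z => max (φ z) M) (hφc.sup continuousOn_const) hr hm)
    fun τ _ => le_max_left _ _)

theorem IsPseudoconvex.discProperty {D : Set (EuclideanSpace ℂ (Fin n))} (h : IsPseudoconvex D) :
    DiscProperty D := by
  obtain ⟨hD, φ, hφc, hφ, hex⟩ := h
  exact discProperty_of_exhaustion hD hφc (hφ.submeanOn hD hφc) hex

theorem isPseudoconvex_of_local_discProperty {D : Set (EuclideanSpace ℂ (Fin n))} (hD : IsOpen D)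
    (hb : Bornology.IsBounded D) (hne : Dᶜ.Nonempty)
    (hloc : ∀ ζ ∈ frontier D, ∃ r : ℝ, 0 < r ∧ DiscProperty (Metric.ball ζ r ∩ D)) :
    IsPseudoconvex D := by
  obtain ⟨φ, hφc, hφ, hex⟩ := exists_exhaustion_of_local_discProperty hD hb hne hloc
  exact ⟨hD, φ, hφc, hφ.plurisubharmonicOn hD hφc, hex⟩

end Pseudoconvex

/-! ### The proposition -/

theorem proposition2p3 (n : ℕ) (Ω F U : Set (EuclideanSpace ℂ (Fin n)))
    (v : EuclideanSpace ℂ (Fin n) → EReal)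
    (hΩo : IsOpen Ω) (hΩc : IsConnected Ω) (hΩb : Bornology.IsBounded Ω)
    (hFne : F.Nonempty) (hFc : IsClosed F) (hF : F ⊆ frontier Ω)
    (hloc : IsLocallyPseudoconvexAlong Ω (frontier Ω \ F))
    (hU : IsPseudoconvex U) (hFU : F ⊆ U)
    (hvc : ContinuousOn v (U ∩ Ω)) (hv : PlurisubharmonicOn v (U ∩ Ω))
    (hFv : F = {z ∈ frontier Ω | z ∈ closure (U ∩ Ω) ∧ Tendsto v (𝓝[U ∩ Ω] z) (𝓝 ⊤)}) :
    IsPseudoconvex Ω := by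
  have hUo : IsOpen U := hU.1
  have hUΩ : IsOpen (U ∩ Ω) := hUo.inter hΩo
  have hne : Ωᶜ.Nonempty := by
    obtain ⟨ζ, hζ⟩ := hFne
    have := hF hζ
    rw [hΩo.frontier_eq] at this
    exact ⟨ζ, this.2⟩
  have hUd := hU.discProperty
  set w : EuclideanSpace ℂ (Fin n) → ℝ := fun z => (max (v z) 0).toReal with hw
  have hwc : ContinuousOn w (U ∩ Ω) := hvc.toReal_max_zero hv.lt_top
  have hws : SubmeanOn w (U ∩ Ω) := hv.submeanOn_max_zero
  have hsub : ∀ c : ℝ, DiscProperty {z ∈ U ∩ Ω | w z < c} := by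
    intro c
    set D := {z ∈ U ∩ Ω | w z < c} with hDdef
    have hDo : IsOpen D := hwc.isOpen_inter_preimage hUΩ isOpen_Iio
    have hDsub : D ⊆ U ∩ Ω := sep_subset _ _
    refine (isPseudoconvex_of_local_discProperty hDo (hΩb.subset fun z hz => (hDsub hz).2)
      (hne.mono (compl_subset_compl.2 fun z hz => (hDsub hz).2)) fun ζ hζ => ?_).discProperty
    have hball : ∀ r : ℝ, DiscProperty (Metric.ball ζ r ∩ Ω) →
        DiscProperty (Metric.ball ζ r ∩ D) := by
      intro r h
      have hsubset : U ∩ (Metric.ball ζ r ∩ Ω) ⊆ U ∩ Ω :=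
        inter_subset_inter_right _ inter_subset_right
      have := (hUd.inter h).sublevel (hUo.inter (Metric.isOpen_ball.inter hΩo))
        (hwc.mono hsubset) (hws.mono hsubset) c
      have heq : Metric.ball ζ r ∩ D = {z ∈ U ∩ (Metric.ball ζ r ∩ Ω) | w z < c} :=
        Subset.antisymm (fun z hz => ⟨⟨hz.2.1.1, hz.1, hz.2.1.2⟩, hz.2.2⟩)
          fun z hz => ⟨hz.1.2.1, ⟨hz.1.1, hz.1.2.2⟩, hz.2⟩
      rwa [heq]
    have hζcl : ζ ∈ closure (U ∩ Ω) := closure_mono hDsub (frontier_subset_closure hζ)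
    by_cases hζΩ : ζ ∈ Ω
    -- A boundary point of `D` inside `Ω` may lie on `∂U` or on `{w = c}`; `hball` covers both,
    -- needing only the principle for a ball.
    · obtain ⟨r, hr, hrΩ⟩ := Metric.isOpen_iff.1 hΩo ζ hζΩ
      refine ⟨r, hr, hball r ?_⟩
      rw [inter_eq_left.2 hrΩ]
      exact discProperty_ball ζ r
    have hζf : ζ ∈ frontier Ω := by
      rw [hΩo.frontier_eq]
      exact ⟨closure_mono inter_subset_right hζcl, hζΩ⟩
    have hζF : ζ ∉ F := by
      intro hζF
      rw [hFv] at hζF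
      have hev := hζF.2.2.eventually (lt_mem_nhds (EReal.coe_lt_top (max c 0)))
      rw [eventually_nhdsWithin_iff] at hev
      -- Points of `D` accumulate at `ζ`, yet near a point of `F` one has `v > max c 0`, against `w
      -- < c`.
      have hfr : ∃ᶠ z in 𝓝 ζ, z ∈ D := mem_closure_iff_frequently.1 (frontier_subset_closure hζ)
      obtain ⟨z, hzD, hz⟩ := (hfr.and_eventually hev).exists
      have h1 := hz hzD.1
      have h2 : max c 0 ≤ w z := by
        have := EReal.toReal_le_toReal (h1.le.trans (le_max_left (v z) 0)) (EReal.coe_ne_bot _)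
          (max_lt (hv.lt_top z hzD.1) EReal.zero_lt_top).ne
        rwa [EReal.toReal_coe] at this
      exact absurd hzD.2 (not_lt.2 ((le_max_left _ _).trans h2))
    obtain ⟨r, hr, h⟩ := hloc ζ ⟨hζf, hζF⟩
    exact ⟨r, hr, hball r h.discProperty⟩
  have hd : DiscProperty (U ∩ Ω) := discProperty_of_sublevel hwc hsub
  refine isPseudoconvex_of_local_discProperty hΩo hΩb hne fun ζ hζ => ?_
  by_cases hζF : ζ ∈ F
  · obtain ⟨r, hr, hrU⟩ := Metric.isOpen_iff.1 hUo ζ (hFU hζF)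
    refine ⟨r, hr, ?_⟩
    have := (discProperty_ball ζ r).inter hd
    rwa [← inter_assoc, inter_eq_left.2 hrU] at this
  · obtain ⟨r, hr, h⟩ := hloc ζ ⟨hζ, hζF⟩
    exact ⟨r, hr, h.discProperty⟩
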